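/- For a positive integer $a$ let $[a]_q = 1+q+\cdots+q^{a-1}$. For each $N\ge 1$ let $a^{(N)}$ be a nonempty finite multiset of integers, all of them $\ge 2$. Let $f_N(q)=\prod_{a\in a^{(N)}}[a]_q=\sum_k c_k^{(N)}q^k$, and let $\mathcal X_N$ be a random variable with $\mathbb P(\mathcal X_N=k)=c_k^{(N)}/f_N(1)$ for all $k\ge 0$. For a random variable $\mathcal X$ with mean $\mu$ and standard deviation $\sigma>0$ put $\mathcal X^*=(\mathcal X-\mu)/\sigma$. (i) If $$\sum_{a\in a^{(N)}}\left(\frac{a}{\max a^{(N)}}\right)^4\to\infty\qquad (N\to\infty),$$ then $\mathcal X_1,\mathcal X_2,\ldots$ is asymptotically normal, that is, $\mathcal X_N^*$ converges in distribution to $\mathcal N(0,1)$. For (ii), write $\widetilde\ell_{\le m}$ for the set of weakly decreasing sequences $\mathbf t=(t_1\ge t_2\ge\cdots\ge 0)$ of nonnegative reals with at most $m$ nonzero entries. A multiset of at most $m$ nonnegative reals is regarded as an element of $\widetilde\ell_{\le m}$ by sorting it in decreasing order and appending zeros. Let $|a^{(N)}|_2=\bigl(\sum_{a\in a^{(N)}}a^2\bigr)^{1/2}$,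 and for $\mathbf t\in\widetilde\ell_{\le m}$ let $\mathcal S_{\mathbf t}=\sum_k\mathcal U[-t_k/2,t_k/2]$ be a sum of independent continuous uniform random variables (with $\mathcal U[0,0]=0$). (ii) Suppose that the cardinalities of the multisets $a^{(N)}$ are bounded by some $m$ and that $\max a^{(N)}\to\infty$. Then $\mathcal X_1^*,\mathcal X_2^*,\ldots$ converges in distribution (to some real random variable) if and only if the rescaled multisets $a^{(N)}/|a^{(N)}|_2\in\widetilde\ell_{\le m}$ converge pointwise (i.e. entry by entry, as decreasing sequences) to some $\mathbf t\in\widetilde\ell_{\le m}$. In that case the limiting distribution is that of the standardized uniform sum $\mathcal S_{\mathbf t}^*$. (iii) Suppose that the cardinalities of the multisets $a^{(N)}$ are bounded and that $\max a^{(N)}$ is also bounded. Then $\mathcal X_1^*,\mathcal X_2^*,\ldots$ converges in distribution if and only if $a^{(N)}$ is eventually a constant multiset. -/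

import Mathlib

open MeasureTheory ProbabilityTheory Filter Topology
open scoped Polynomial

noncomputable section

/-- The `q`-integer `[a]_q = 1 + q + ⋯ + q^(a-1)`. -/
def qInt (a : ℕ) : ℕ[X] := ∑ i ∈ Finset.range a, Polynomial.X ^ i

/-- The product `∏_{x ∈ a} [x]_q` of `q`-integers over a multiset `a`. -/
def qProd (a : Multiset ℕ) : ℕ[X] := (a.map qInt).prod

/-- `X` is a random variable associated with the generating polynomial `f = ∑ c_k q^k`, that is
`P(X = k) = c_k / f(1)` for every `k`. When `f ≠ 0` and `P` is a probability measure this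
determines the law of `X`. -/
def IsAssociated {Ω : Type*} [MeasurableSpace Ω] (f : ℕ[X]) (X : Ω → ℝ) (P : Measure Ω) : Prop :=
  AEMeasurable X P ∧
    ∀ k : ℕ, P.real {ω | X ω = (k : ℝ)} = (f.coeff k : ℝ) / (f.eval 1 : ℕ)

/-- The standardization `X* = (X - μ) / σ` of a random variable with mean `μ` and
standard deviation `σ`. -/
def standardize {Ω : Type*} [MeasurableSpace Ω] (X : Ω → ℝ) (P : Measure Ω) : Ω → ℝ :=
  fun ω ↦ (X ω - ∫ ω', X ω' ∂P) / √(Var[X; P])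

/-- A sequence of random variables converges in distribution (to some real random variable,
which may be taken to be the identity on `ℝ` equipped with its law). -/
def ConvergesInDistribution {Ω : ℕ → Type*} [∀ N, MeasurableSpace (Ω N)]
    (Y : ∀ N, Ω N → ℝ) (P : ∀ N, Measure (Ω N)) [∀ N, IsProbabilityMeasure (P N)] : Prop :=
  ∃ ν : ProbabilityMeasure ℝ, TendstoInDistribution Y atTop (id : ℝ → ℝ) P (ν : Measure ℝ)

/-- Asymptotic normality: `X_N* ⇒ 𝒩(0, 1)`. -/
def AsymptoticallyNormal {Ω : ℕ → Type*} [∀ N, MeasurableSpace (Ω N)]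
    (X : ∀ N, Ω N → ℝ) (P : ∀ N, Measure (Ω N)) [∀ N, IsProbabilityMeasure (P N)] : Prop :=
  TendstoInDistribution (fun N ↦ standardize (X N) (P N)) atTop (id : ℝ → ℝ) P (gaussianReal 0 1)

/-- A finite multiset of real numbers as a weakly decreasing sequence: sort it in decreasing order
and append zeros. -/
def decreasingSeq (s : Multiset ℝ) : ℕ → ℝ := fun k ↦ (s.sort (fun x y ↦ x ≥ y)).getD k 0

/-- The rescaled multiset `a / |a|₂`, where `|a|₂ = (∑_{x ∈ a} x²)^(1/2)`. -/
def rescaled (a : Multiset ℕ) : Multiset ℝ :=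
  a.map fun x : ℕ ↦ (x : ℝ) / √((a.map fun y : ℕ ↦ (y : ℝ) ^ 2).sum)

/-- The weakly decreasing sequences of nonnegative reals with at most `m` nonzero entries. -/
def decreasingSpace (m : ℕ) : Set (ℕ → ℝ) :=
  {t | Antitone t ∧ (∀ k, 0 ≤ t k) ∧ (Function.support t).encard ≤ m}

/-- The law of an i.i.d. sequence of uniform random variables on `[-1/2, 1/2]`. -/
def uniformSeqMeasure : Measure (ℕ → ℝ) :=
  Measure.infinitePi fun _ ↦ (volume : Measure ℝ).restrict (Set.Icc (-1 / 2) (1 / 2))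

instance isProbabilityMeasure_uniformInterval :
    IsProbabilityMeasure ((volume : Measure ℝ).restrict (Set.Icc (-1 / 2) (1 / 2))) :=
  ⟨by rw [Measure.restrict_apply_univ, Real.volume_Icc]; norm_num⟩

instance isProbabilityMeasure_uniformSeqMeasure : IsProbabilityMeasure uniformSeqMeasure := by
  unfold uniformSeqMeasure; infer_instance

/-- The uniform sum random variable `S_t = 𝒰[-t₁/2, t₁/2] + 𝒰[-t₂/2, t₂/2] + ⋯` with independent
summands, on the space of i.i.d. uniform sequences: the `k`-th summand is `t_k ω_k`, and the sum is
the limit of the partial sums (which exists almost surely when `∑ t_k² < ∞`). -/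
def uniformSum (t : ℕ → ℝ) : (ℕ → ℝ) → ℝ :=
  fun ω ↦ limUnder atTop fun n ↦ ∑ k ∈ Finset.range n, t k * ω k

end

namespace IsAssociated

variable {Ω : Type*} [MeasurableSpace Ω] {P : Measure Ω}
  {f : ℕ[X]} {X : Ω → ℝ}

lemma aemeasurable_standardize (h : IsAssociated f X P) : AEMeasurable (standardize X P) P :=
  (h.1.sub_const _).div_const _

lemma measureReal_singleton (h : IsAssociated f X P) (k : ℕ) :
    (P.map X).real {(k : ℝ)} = (f.coeff k : ℝ) / (f.eval 1 : ℕ) := by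
  rw [← h.2 k, measureReal_def, Measure.map_apply_of_aemeasurable h.1 (measurableSet_singleton _)]
  rfl

lemma ae_mem_support [IsProbabilityMeasure P] (h : IsAssociated f X P) (hf : f.eval 1 ≠ 0) :
    ∀ᵐ x ∂(P.map X), x ∈ (f.support.image (Nat.cast : ℕ → ℝ) : Set ℝ) := by
  have := Measure.isProbabilityMeasure_map (μ := P) h.1
  have hS : (P.map X).real (f.support.image (Nat.cast : ℕ → ℝ) : Finset ℝ) = 1 := by
    rw [← sum_measureReal_singleton, Finset.sum_image (by simp)]
    simp_rw [h.measureReal_singleton]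
    rw [← Finset.sum_div, div_eq_one_iff_eq (by exact_mod_cast hf), Polynomial.eval_eq_sum,
      Polynomial.sum]
    simp
  rw [Filter.eventually_iff, mem_ae_iff, ← measureReal_eq_zero_iff]
  have := probReal_compl_eq_one_sub (μ := P.map X)
    (f.support.image (Nat.cast : ℕ → ℝ)).measurableSet
  rw [hS, sub_self] at this
  exact this

/-- Expectations of functions of a random variable associated with a polynomial. -/
lemma integral_comp [IsProbabilityMeasure P] {E : Type*} [NormedAddCommGroup E] [NormedSpace ℝ E] [CompleteSpace E]
    (h : IsAssociated f X P) (hf : f.eval 1 ≠ 0) (F : ℝ → E) :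
    ∫ x, F x ∂(P.map X) =
      ∑ k ∈ f.support, ((f.coeff k : ℝ) / (f.eval 1 : ℕ)) • F k := by
  have := Measure.isProbabilityMeasure_map (μ := P) h.1
  rw [← Measure.restrict_eq_self_of_ae_mem (h.ae_mem_support hf),
    setIntegral_finset _ IntegrableOn.finset, Finset.sum_image (by simp)]
  simp_rw [h.measureReal_singleton]

lemma integrable_map [IsProbabilityMeasure P] {E : Type*} [NormedAddCommGroup E]
    (h : IsAssociated f X P) (hf : f.eval 1 ≠ 0) (F : ℝ → E) : Integrable F (P.map X) := by
  have := Measure.isProbabilityMeasure_map (μ := P) h.1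
  rw [← Measure.restrict_eq_self_of_ae_mem (h.ae_mem_support hf)]
  exact IntegrableOn.finset

lemma integral_eq [IsProbabilityMeasure P] (h : IsAssociated f X P) (hf : f.eval 1 ≠ 0) :
    ∫ ω, X ω ∂P = (f.derivative.eval 1 : ℕ) / (f.eval 1 : ℕ) := by
  have h1 : ∫ ω, X ω ∂P = ∫ x, x ∂(P.map X) :=
    (integral_map h.1 (f := fun x : ℝ ↦ x) (by fun_prop)).symm
  rw [h1, h.integral_comp hf, Polynomial.derivative_eval, Polynomial.sum, Nat.cast_sum,
    Finset.sum_div]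
  refine Finset.sum_congr rfl fun k _ ↦ ?_
  simp
  ring

lemma integral_sq_eq [IsProbabilityMeasure P] (h : IsAssociated f X P) (hf : f.eval 1 ≠ 0) :
    ∫ ω, X ω ^ 2 ∂P =
      ((f.derivative.derivative.eval 1 : ℕ) + (f.derivative.eval 1 : ℕ)) / (f.eval 1 : ℕ) := by
  have h1 : ∫ ω, X ω ^ 2 ∂P = ∫ x, x ^ 2 ∂(P.map X) :=
    (integral_map h.1 (f := fun x : ℝ ↦ x ^ 2) (by fun_prop)).symm
  have h2 : f.derivative.derivative.eval 1 + f.derivative.eval 1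
      = ∑ k ∈ f.support, f.coeff k * k ^ 2 := by
    clear h hf h1
    change _ = f.sum fun k c ↦ c * k ^ 2
    induction f using Polynomial.induction_on' with
    | add p q hp hq =>
      rw [Polynomial.sum_add_index p q _ (by simp) (fun _ _ _ ↦ add_mul _ _ _)]
      simp only [map_add, Polynomial.eval_add]
      omega
    | monomial n c =>
      rw [Polynomial.sum_monomial_index _ _ (by simp)]
      rcases n with _ | _ | n
      · simp
      · simp
      · simp
        ring
  rw [h1, h.integral_comp hf, ← Nat.cast_add, h2, Nat.cast_sum, Finset.sum_div]
  refine Finset.sum_congr rfl fun k _ ↦ ?_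
  simp
  ring

lemma variance_eq [IsProbabilityMeasure P] (h : IsAssociated f X P) (hf : f.eval 1 ≠ 0) :
    Var[X; P] = ((f.derivative.derivative.eval 1 : ℕ) + (f.derivative.eval 1 : ℕ) : ℝ) /
      (f.eval 1 : ℕ) - ((f.derivative.eval 1 : ℕ) / (f.eval 1 : ℕ)) ^ 2 := by
  have hL : MemLp X 2 P := by
    rw [memLp_two_iff_integrable_sq h.1.aestronglyMeasurable]
    exact (h.integrable_map hf fun x ↦ x ^ 2).comp_aemeasurable h.1
  rw [variance_eq_sub hL, h.integral_eq hf, ← h.integral_sq_eq hf]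
  rfl

lemma charFun_standardize [IsProbabilityMeasure P] (h : IsAssociated f X P) (hf : f.eval 1 ≠ 0)
    (ξ : ℝ) : charFun (P.map (standardize X P)) ξ =
      Complex.exp (-(∫ ω, X ω ∂P : ℝ) * (ξ / √(Var[X; P]) : ℝ) * Complex.I) *
        f.eval₂ (Nat.castRingHom ℂ) (Complex.exp ((ξ / √(Var[X; P]) : ℝ) * Complex.I)) /
          (f.eval 1 : ℕ) := by
  set μ := ∫ ω, X ω ∂P with hμ
  set σ := √(Var[X; P]) with hσ
  have hst : P.map (standardize X P) = (P.map X).map fun x ↦ (x - μ) / σ :=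
    (AEMeasurable.map_map_of_aemeasurable (g := fun x : ℝ ↦ (x - μ) / σ) (by fun_prop) h.1).symm
  rw [hst, charFun_apply_real, integral_map (by fun_prop) (by fun_prop), h.integral_comp hf,
    Polynomial.eval₂_eq_sum, Polynomial.sum, Finset.mul_sum, Finset.sum_div]
  refine Finset.sum_congr rfl fun k _ ↦ ?_
  rw [← Complex.exp_nat_mul]
  simp only [Complex.real_smul, eq_natCast]
  push_cast
  have : (ξ : ℂ) * ((k - μ) / σ) * Complex.I
    = -μ * (ξ / σ) * Complex.I + k * (ξ / σ * Complex.I) := by ring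
  rw [this, Complex.exp_add]
  ring

end IsAssociated

noncomputable section

/-! ### Mean, variance and characteristic function -/

/-- The mean of the random variable associated with `qProd a`. -/
def qMean (a : Multiset ℕ) : ℝ := (a.map fun x : ℕ ↦ ((x : ℝ) - 1) / 2).sum

/-- The variance of the random variable associated with `qProd a`. -/
def qVar (a : Multiset ℕ) : ℝ := (a.map fun x : ℕ ↦ ((x : ℝ) ^ 2 - 1) / 12).sum

/-- The characteristic function of the uniform distribution on the `a` points
`-(a - 1) / 2, …, (a - 1) / 2`. -/
def uniformCharFun (a : ℕ) (s : ℝ) : ℝ :=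
  (∑ k ∈ Finset.range a, Real.cos ((k - ((a : ℝ) - 1) / 2) * s)) / a

/-- The characteristic function of the standardized random variable associated with `qProd a`. -/
def qCharFun (a : Multiset ℕ) (ξ : ℝ) : ℝ :=
  (a.map fun x ↦ uniformCharFun x (ξ / √(qVar a))).prod

lemma qInt_succ (n : ℕ) : qInt (n + 1) = qInt n + Polynomial.X ^ n :=
  Finset.sum_range_succ _ _

lemma eval_one_qInt (n : ℕ) : (qInt n).eval 1 = n := by
  simp [qInt, Polynomial.eval_finsetSum]

lemma eval_one_derivative_qInt (n : ℕ) :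
    (((qInt n).derivative.eval 1 : ℕ) : ℝ) = n * ((n - 1) / 2) := by
  induction n with
  | zero => simp [qInt]
  | succ n ih =>
    simp only [qInt_succ, map_add, Polynomial.eval_add, Nat.cast_add, ih]
    simp [Polynomial.derivative_X_pow]
    ring

lemma eval_one_derivative_derivative_qInt (n : ℕ) :
    (((qInt n).derivative.derivative.eval 1 : ℕ) : ℝ) =
      n * ((n ^ 2 - 1) / 12 + ((n - 1) / 2) ^ 2 - (n - 1) / 2) := by
  induction n with
  | zero => simp [qInt]
  | succ n ih =>
    simp only [qInt_succ, map_add, Polynomial.eval_add, Nat.cast_add, ih]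
    rcases n with _ | n
    · simp
    · simp [Polynomial.derivative_X_pow]
      ring

lemma qProd_zero : qProd 0 = 1 := by simp [qProd]

lemma qProd_cons (x : ℕ) (a : Multiset ℕ) : qProd (x ::ₘ a) = qInt x * qProd a := by simp [qProd]

lemma eval_one_qProd (a : Multiset ℕ) : (qProd a).eval 1 = a.prod := by
  induction a using Multiset.induction_on with
  | empty => simp [qProd_zero]
  | cons x a ih => simp [qProd_cons, ih, eval_one_qInt]

lemma eval_one_derivative_qProd (a : Multiset ℕ) :
    (((qProd a).derivative.eval 1 : ℕ) : ℝ) = a.prod * qMean a := by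
  induction a using Multiset.induction_on with
  | empty => simp [qProd_zero, qMean]
  | cons x a ih =>
    simp only [qProd_cons, Polynomial.derivative_mul, Polynomial.eval_add, Polynomial.eval_mul,
      eval_one_qProd, eval_one_qInt, Nat.cast_add, Nat.cast_mul, eval_one_derivative_qInt, ih]
    simp [qMean]
    ring

lemma eval_one_derivative_derivative_qProd (a : Multiset ℕ) :
    (((qProd a).derivative.derivative.eval 1 : ℕ) : ℝ) =
      a.prod * (qVar a + qMean a ^ 2 - qMean a) := by
  induction a using Multiset.induction_on with
  | empty => simp [qProd_zero, qMean, qVar]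
  | cons x a ih =>
    simp only [qProd_cons, Polynomial.derivative_mul, Polynomial.eval_add, Polynomial.eval_mul,
      eval_one_qProd, eval_one_qInt, Nat.cast_add, Nat.cast_mul, eval_one_derivative_qInt, ih,
      eval_one_derivative_derivative_qInt, map_add, eval_one_derivative_qProd]
    simp [qMean, qVar]
    ring

lemma eval_one_qProd_ne_zero {a : Multiset ℕ} (ha : ∀ x ∈ a, 2 ≤ x) : (qProd a).eval 1 ≠ 0 := by
  rw [eval_one_qProd, Ne, Multiset.prod_eq_zero_iff]
  exact fun h ↦ absurd (ha 0 h) (by norm_num)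

lemma exp_mul_sum_exp_div (a : ℕ) (s : ℝ) :
    Complex.exp (-(((a : ℝ) - 1) / 2 : ℝ) * s * Complex.I) *
      (∑ k ∈ Finset.range a, Complex.exp (s * Complex.I) ^ k) / a = uniformCharFun a s := by
  have h1 : Complex.exp (-(((a : ℝ) - 1) / 2 : ℝ) * s * Complex.I) *
      (∑ k ∈ Finset.range a, Complex.exp (s * Complex.I) ^ k)
      = ∑ k ∈ Finset.range a, Complex.exp (((k - ((a : ℝ) - 1) / 2) * s : ℝ) * Complex.I) := by
    rw [Finset.mul_sum]
    refine Finset.sum_congr rfl fun k _ ↦ ?_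
    rw [← Complex.exp_nat_mul, ← Complex.exp_add]
    congr 1
    push_cast
    ring
  have h2 : ∑ k ∈ Finset.range a, Real.sin ((k - ((a : ℝ) - 1) / 2) * s) = 0 := by
    have h := Finset.sum_range_reflect (fun k : ℕ ↦ Real.sin ((k - ((a : ℝ) - 1) / 2) * s)) a
    have h' : ∑ k ∈ Finset.range a, Real.sin (((a - 1 - k : ℕ) - ((a : ℝ) - 1) / 2) * s)
        = ∑ k ∈ Finset.range a, -Real.sin ((k - ((a : ℝ) - 1) / 2) * s) := by
      refine Finset.sum_congr rfl fun k hk ↦ ?_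
      have hk := Finset.mem_range.1 hk
      rw [← Real.sin_neg, Nat.sub_sub, Nat.cast_sub (by omega)]
      congr 1
      push_cast
      ring
    rw [h', Finset.sum_neg_distrib] at h
    linarith
  have h3 : (∑ k ∈ Finset.range a,
      (Real.sin ((k - ((a : ℝ) - 1) / 2) * s) : ℂ)) = 0 := by exact_mod_cast h2
  rw [h1]
  simp_rw [Complex.exp_mul_I, ← Complex.ofReal_cos, ← Complex.ofReal_sin]
  rw [Finset.sum_add_distrib, ← Finset.sum_mul, h3, uniformCharFun]
  push_cast
  ring

lemma uniformCharFun_mul_sinc {a : ℕ} (ha : a ≠ 0) (s : ℝ) :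
    uniformCharFun a s * Real.sinc (s / 2) = Real.sinc (a * (s / 2)) := by
  have ha' : (a : ℝ) ≠ 0 := by exact_mod_cast ha
  rcases eq_or_ne s 0 with rfl | hs
  · simp [uniformCharFun, ha']
  have h : ∀ n : ℕ, 2 * Real.sin (s / 2) *
      ∑ k ∈ Finset.range n, Real.cos ((k - ((a : ℝ) - 1) / 2) * s)
      = Real.sin ((n - (a : ℝ) / 2) * s) + Real.sin ((a : ℝ) / 2 * s) := by
    intro n
    induction n with
    | zero => simp
    | succ n ih =>
      rw [Finset.sum_range_succ, mul_add, ih]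
      have e1 : ((n + 1 : ℕ) - (a : ℝ) / 2) * s = (n - ((a : ℝ) - 1) / 2) * s + s / 2 := by
        push_cast; ring
      have e2 : (n - (a : ℝ) / 2) * s = (n - ((a : ℝ) - 1) / 2) * s - s / 2 := by ring
      rw [e1, e2, Real.sin_add, Real.sin_sub]
      ring
  have h' := h a
  rw [Real.sinc_of_ne_zero (by positivity), Real.sinc_of_ne_zero (by positivity), uniformCharFun]
  generalize ∑ k ∈ Finset.range a, Real.cos ((k - ((a : ℝ) - 1) / 2) * s) = S at *
  have e : ((a : ℝ) - a / 2) * s = a * (s / 2) := by ring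
  have e' : (a : ℝ) / 2 * s = a * (s / 2) := by ring
  rw [e, e'] at h'
  rw [div_mul_div_comm, div_eq_div_iff (by positivity) (by positivity)]
  linear_combination (a * s / 4) * h'

lemma abs_uniformCharFun_le_one (a : ℕ) (s : ℝ) : |uniformCharFun a s| ≤ 1 := by
  rw [uniformCharFun, abs_div, Nat.abs_cast]
  refine div_le_one_of_le₀ ((Finset.abs_sum_le_sum_abs _ _).trans ?_) (by positivity)
  simpa using Finset.sum_le_card_nsmul (Finset.range a) _ 1 fun k _ ↦ Real.abs_cos_le_one _

namespace IsAssociated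

variable {Ω : Type*} [MeasurableSpace Ω] {P : Measure Ω} [IsProbabilityMeasure P]
  {a : Multiset ℕ} {X : Ω → ℝ}

lemma integral_qProd (ha : ∀ x ∈ a, 2 ≤ x) (h : IsAssociated (qProd a) X P) :
    ∫ ω, X ω ∂P = qMean a := by
  have h0 := eval_one_qProd_ne_zero ha
  rw [h.integral_eq h0, eval_one_derivative_qProd, eval_one_qProd]
  rw [eval_one_qProd] at h0
  have : (a.prod : ℝ) ≠ 0 := by exact_mod_cast h0
  field_simp

lemma variance_qProd (ha : ∀ x ∈ a, 2 ≤ x) (h : IsAssociated (qProd a) X P) :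
    Var[X; P] = qVar a := by
  have h0 := eval_one_qProd_ne_zero ha
  rw [h.variance_eq h0, eval_one_derivative_qProd, eval_one_derivative_derivative_qProd,
    eval_one_qProd]
  rw [eval_one_qProd] at h0
  have : (a.prod : ℝ) ≠ 0 := by exact_mod_cast h0
  field_simp
  ring


lemma charFun_standardize_qProd (ha : ∀ x ∈ a, 2 ≤ x) (h : IsAssociated (qProd a) X P) (ξ : ℝ) :
    charFun (P.map (standardize X P)) ξ =
      qCharFun a ξ := by
  rw [h.charFun_standardize (eval_one_qProd_ne_zero ha), h.integral_qProd ha, h.variance_qProd ha,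
    eval_one_qProd, qCharFun]
  generalize ξ / √(qVar a) = s
  clear h ha
  induction a using Multiset.induction_on with
  | empty => simp [qMean, qProd_zero]
  | cons x a ih =>
    rw [Multiset.map_cons, Multiset.prod_cons, Multiset.prod_cons, Complex.ofReal_mul, ← ih, ← exp_mul_sum_exp_div,
      qProd_cons, Polynomial.eval₂_mul, qMean, Multiset.map_cons, Multiset.sum_cons, ← qMean]
    have h1 : (qInt x).eval₂ (Nat.castRingHom ℂ) (Complex.exp (s * Complex.I))
        = ∑ k ∈ Finset.range x, Complex.exp (s * Complex.I) ^ k := by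
      simp [qInt, Polynomial.eval₂_finsetSum]
    have h2 : -(((((x : ℝ) - 1) / 2 + qMean a : ℝ)) : ℂ) * s * Complex.I
        = -(((x : ℝ) - 1) / 2 : ℝ) * s * Complex.I + -(qMean a) * s * Complex.I := by
      push_cast; ring
    rw [h1, h2, Complex.exp_add]
    push_cast
    ring

end IsAssociated

end

noncomputable section

/-! ### Asymptotic normality -/

lemma Multiset.abs_prod_map_le_one {ι : Type*} (s : Multiset ι) (f : ι → ℝ)
    (hf : ∀ i ∈ s, |f i| ≤ 1) : |(s.map f).prod| ≤ 1 := by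
  induction s using Multiset.induction_on with
  | empty => simp
  | cons x s ih =>
    rw [Multiset.map_cons, Multiset.prod_cons, abs_mul]
    exact mul_le_one₀ (hf x (by simp)) (abs_nonneg _) (ih fun i hi ↦ hf i (by simp [hi]))

lemma Multiset.abs_prod_map_sub_prod_map_le {ι : Type*} (s : Multiset ι) (f g : ι → ℝ)
    (hf : ∀ i ∈ s, |f i| ≤ 1) (hg : ∀ i ∈ s, |g i| ≤ 1) :
    |(s.map f).prod - (s.map g).prod| ≤ (s.map fun i ↦ |f i - g i|).sum := by
  induction s using Multiset.induction_on with
  | empty => simp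
  | cons x s ih =>
    have hg' : |(s.map g).prod| ≤ 1 :=
      Multiset.abs_prod_map_le_one s g fun i hi ↦ hg i (by simp [hi])
    have ih := ih (fun i hi ↦ hf i (by simp [hi])) (fun i hi ↦ hg i (by simp [hi]))
    simp only [Multiset.map_cons, Multiset.prod_cons, Multiset.sum_cons]
    have e : f x * (s.map f).prod - g x * (s.map g).prod
      = f x * ((s.map f).prod - (s.map g).prod) + (f x - g x) * (s.map g).prod := by ring
    rw [e, add_comm |f x - g x|]
    refine (abs_add_le _ _).trans (add_le_add ?_ ?_)
    · rw [abs_mul]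
      exact (mul_le_of_le_one_left (abs_nonneg _) (hf x (by simp))).trans ih
    · rw [abs_mul]
      exact mul_le_of_le_one_right (abs_nonneg _) hg'

lemma sum_centered_sq (a : ℕ) :
    ∑ k ∈ Finset.range a, ((k : ℝ) - ((a : ℝ) - 1) / 2) ^ 2 = a * (((a : ℝ) ^ 2 - 1) / 12) := by
  have h : ∀ n : ℕ, ∀ c : ℝ, ∑ k ∈ Finset.range n, ((k : ℝ) - c) ^ 2
      = n * (n - 1) * (2 * n - 1) / 6 - c * n * (n - 1) + n * c ^ 2 := by
    intro n c
    induction n with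
    | zero => simp
    | succ n ih => rw [Finset.sum_range_succ, ih]; push_cast; ring
  rw [h]
  ring

lemma abs_uniformCharFun_sub_exp_le {a : ℕ} (ha : 2 ≤ a) {s r : ℝ} (har : a * |s| ≤ r)
    (hr : r ≤ 1) :
    |uniformCharFun a s - Real.exp (-(((a : ℝ) ^ 2 - 1) / 12 * s ^ 2 / 2))| ≤
      ((a : ℝ) ^ 2 - 1) / 12 * (2 * s ^ 2 * r ^ 2) := by
  have ha' : (2 : ℝ) ≤ a := by exact_mod_cast ha
  have hr0 : 0 ≤ r := le_trans (by positivity) har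
  set v : ℝ := ((a : ℝ) ^ 2 - 1) / 12 with hv
  have hv0 : 0 ≤ v := by rw [hv]; nlinarith
  have hvr : v * s ^ 2 ≤ r ^ 2 := by
    have h1 : (a * |s|) ^ 2 ≤ r ^ 2 := by gcongr
    rw [mul_pow, sq_abs] at h1
    refine le_trans ?_ h1
    gcongr
    rw [hv]; nlinarith
  have hr2 : r ^ 2 ≤ 1 := pow_le_one₀ hr0 hr
  have hvs : 0 ≤ v * s ^ 2 := by positivity
  have h1 : |uniformCharFun a s - (1 - v * s ^ 2 / 2)| ≤ v * s ^ 2 * r ^ 2 := by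
    have e : uniformCharFun a s - (1 - v * s ^ 2 / 2)
        = (∑ k ∈ Finset.range a, (Real.cos ((k - ((a : ℝ) - 1) / 2) * s)
          - (1 - ((k - ((a : ℝ) - 1) / 2) * s) ^ 2 / 2))) / a := by
      simp_rw [Finset.sum_sub_distrib, ← Finset.sum_div, mul_pow, ← Finset.sum_mul,
        sum_centered_sq, uniformCharFun, ← hv]
      generalize ∑ k ∈ Finset.range a, Real.cos ((k - ((a : ℝ) - 1) / 2) * s) = S
      simp
      field_simp
    have e' : v * s ^ 2 * r ^ 2
        = (∑ k ∈ Finset.range a, ((k - ((a : ℝ) - 1) / 2) * s) ^ 2 * r ^ 2) / a := by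
      simp_rw [mul_pow, ← Finset.sum_mul, sum_centered_sq, ← hv]
      field_simp
    rw [e, e', abs_div, Nat.abs_cast]
    gcongr
    refine (Finset.abs_sum_le_sum_abs _ _).trans (Finset.sum_le_sum fun k hk ↦ ?_)
    set y : ℝ := (k - ((a : ℝ) - 1) / 2) * s with hy
    have hk : (k : ℝ) + 1 ≤ a := by exact_mod_cast Finset.mem_range.1 hk
    have hyr : |y| ≤ r := by
      refine le_trans ?_ har
      rw [hy, abs_mul]
      gcongr
      rw [abs_le]
      constructor <;> linarith [(Nat.cast_nonneg k : (0 : ℝ) ≤ k)]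
    have hy2 : y ^ 2 ≤ r ^ 2 := by rw [← sq_abs]; gcongr
    calc _ ≤ |y| ^ 4 * (5 / 96) := Real.cos_bound (hyr.trans hr)
      _ = y ^ 2 * y ^ 2 * (5 / 96) := by rw [← sq_abs y]; ring
      _ ≤ y ^ 2 * r ^ 2 * 1 := by gcongr; norm_num
      _ = _ := mul_one _
  have h2 : |Real.exp (-(v * s ^ 2 / 2)) - (1 - v * s ^ 2 / 2)| ≤ v * s ^ 2 * r ^ 2 := by
    have := Real.abs_exp_sub_one_sub_id_le (x := -(v * s ^ 2 / 2)) (by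
      rw [abs_neg, abs_of_nonneg (by positivity)]; linarith)
    rw [show Real.exp (-(v * s ^ 2 / 2)) - (1 - v * s ^ 2 / 2)
      = Real.exp (-(v * s ^ 2 / 2)) - 1 - -(v * s ^ 2 / 2) by ring]
    refine this.trans ?_
    nlinarith
  calc _ ≤ _ + _ := abs_sub_le _ (1 - v * s ^ 2 / 2) _
    _ ≤ v * s ^ 2 * r ^ 2 + v * s ^ 2 * r ^ 2 := by
      rw [abs_sub_comm (1 - v * s ^ 2 / 2)]; gcongr
    _ = _ := by ring

/-- The variance is comparable to the sum of the squares. -/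
lemma sum_sq_le_qVar {a : Multiset ℕ} (ha : ∀ x ∈ a, 2 ≤ x) :
    (a.map fun x : ℕ ↦ (x : ℝ) ^ 2).sum / 16 ≤ qVar a := by
  rw [div_eq_mul_inv, ← Multiset.sum_map_mul_right]
  refine Multiset.sum_map_le_sum_map _ _ fun x hx ↦ ?_
  have : (2 : ℝ) ≤ x := by exact_mod_cast ha x hx
  nlinarith

lemma sum_sq_pos {a : Multiset ℕ} (ha : ∀ x ∈ a, 2 ≤ x) (hne : a ≠ 0) :
    0 < (a.map fun x : ℕ ↦ (x : ℝ) ^ 2).sum := by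
  obtain ⟨x, hx⟩ := Multiset.exists_mem_of_ne_zero hne
  have h0 : 0 < (x : ℝ) ^ 2 := by have := ha x hx; positivity
  refine h0.trans_le ?_
  refine Multiset.single_le_sum ?_ _ (Multiset.mem_map_of_mem (fun x : ℕ ↦ (x : ℝ) ^ 2) hx)
  simp only [Multiset.mem_map]
  rintro _ ⟨y, _, rfl⟩
  positivity

lemma qVar_pos {a : Multiset ℕ} (ha : ∀ x ∈ a, 2 ≤ x) (hne : a ≠ 0) : 0 < qVar a :=
  (div_pos (sum_sq_pos ha hne) (by norm_num)).trans_le (sum_sq_le_qVar ha)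

lemma abs_qCharFun_sub_exp_le {a : Multiset ℕ} (ha : ∀ x ∈ a, 2 ≤ x) (hne : a ≠ 0) {ξ : ℝ}
    (hr : (a.sup : ℕ) * |ξ / √(qVar a)| ≤ 1) :
    |qCharFun a ξ - Real.exp (-(ξ ^ 2 / 2))| ≤
      2 * ξ ^ 2 * ((a.sup : ℕ) * |ξ / √(qVar a)|) ^ 2 := by
  have hV := qVar_pos ha hne
  set s := ξ / √(qVar a) with hs
  set r := (a.sup : ℕ) * |s| with hr'
  have hs2 : qVar a * s ^ 2 = ξ ^ 2 := by
    rw [hs, div_pow, Real.sq_sqrt hV.le]; field_simp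
  have e1 : Real.exp (-(ξ ^ 2 / 2))
      = (a.map fun x : ℕ ↦ Real.exp (-(((x : ℝ) ^ 2 - 1) / 12 * s ^ 2 / 2))).prod := by
    have : (a.map fun x : ℕ ↦ Real.exp (-(((x : ℝ) ^ 2 - 1) / 12 * s ^ 2 / 2))).prod
        = Real.exp ((a.map fun x : ℕ ↦ (((x : ℝ) ^ 2 - 1) / 12) * (-(s ^ 2 / 2))).sum) := by
      rw [Real.exp_multiset_sum, Multiset.map_map]
      congr 1
      refine Multiset.map_congr rfl fun x _ ↦ ?_
      simp only [Function.comp_apply]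
      congr 1
      ring
    rw [this, Multiset.sum_map_mul_right, ← qVar, ← hs2]
    congr 1
    ring
  have e2 : 2 * ξ ^ 2 * r ^ 2
      = (a.map fun x : ℕ ↦ ((x : ℝ) ^ 2 - 1) / 12 * (2 * s ^ 2 * r ^ 2)).sum := by
    rw [Multiset.sum_map_mul_right, ← qVar, ← hs2]
    ring
  rw [e1, e2, qCharFun]
  refine (Multiset.abs_prod_map_sub_prod_map_le _ _ _ (fun x _ ↦ abs_uniformCharFun_le_one _ _)
    fun x hx ↦ ?_).trans (Multiset.sum_map_le_sum_map _ _ fun x hx ↦ ?_)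
  · have : (2 : ℝ) ≤ x := by exact_mod_cast ha x hx
    rw [Real.abs_exp, Real.exp_le_one_iff, neg_nonpos]
    have : 0 ≤ (x : ℝ) ^ 2 - 1 := by nlinarith
    positivity
  · refine abs_uniformCharFun_sub_exp_le (ha x hx) ?_ hr
    rw [hr']
    gcongr
    exact Multiset.le_sup hx

lemma tendsto_sup_div_sqrt_qVar {a : ℕ → Multiset ℕ} (ha : ∀ N, ∀ x ∈ a N, 2 ≤ x)
    (hne : ∀ N, a N ≠ 0)
    (h : Tendsto (fun N ↦ ((a N).map fun x : ℕ ↦ ((x : ℝ) / ((a N).sup : ℕ)) ^ 4).sum)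
      atTop atTop) :
    Tendsto (fun N ↦ ((a N).sup : ℕ) / √(qVar (a N))) atTop (𝓝 0) := by
  have h1 : Tendsto (fun N ↦ √(qVar (a N)) / ((a N).sup : ℕ)) atTop atTop := by
    have h2 : Tendsto (fun N ↦
        √(((a N).map fun x : ℕ ↦ ((x : ℝ) / ((a N).sup : ℕ)) ^ 4).sum / 16)) atTop atTop :=
      Real.tendsto_sqrt_atTop.comp (h.atTop_div_const (by norm_num))
    refine tendsto_atTop_mono (fun N ↦ ?_) h2
    obtain ⟨x, hx⟩ := Multiset.exists_mem_of_ne_zero (hne N)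
    have hM : 0 < (((a N).sup : ℕ) : ℝ) := by
      exact_mod_cast lt_of_lt_of_le (by norm_num) ((ha N x hx).trans (Multiset.le_sup hx))
    rw [← Real.sqrt_sq hM.le, ← Real.sqrt_div' _ (by positivity), Real.sqrt_sq hM.le]
    refine Real.sqrt_le_sqrt ?_
    rw [le_div_iff₀ (by positivity)]
    refine le_trans ?_ (sum_sq_le_qVar (ha N))
    rw [div_mul_eq_mul_div]
    gcongr
    rw [← Multiset.sum_map_mul_right]
    refine Multiset.sum_map_le_sum_map _ _ fun y hy ↦ ?_
    have hyM : (y : ℝ) / ((a N).sup : ℕ) ≤ 1 :=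
      div_le_one_of_le₀ (by exact_mod_cast Multiset.le_sup hy) hM.le
    calc ((y : ℝ) / ((a N).sup : ℕ)) ^ 4 * (((a N).sup : ℕ) : ℝ) ^ 2
        ≤ ((y : ℝ) / ((a N).sup : ℕ)) ^ 2 * (((a N).sup : ℕ) : ℝ) ^ 2 := by
          gcongr ?_ * _
          exact pow_le_pow_of_le_one (by positivity) hyM (by norm_num)
      _ = (y : ℝ) ^ 2 := by rw [div_pow]; field_simp
  simpa [Function.comp_def] using tendsto_inv_atTop_zero.comp h1

lemma tendsto_qCharFun_exp {a : ℕ → Multiset ℕ} (ha : ∀ N, ∀ x ∈ a N, 2 ≤ x)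
    (hne : ∀ N, a N ≠ 0)
    (h : Tendsto (fun N ↦ ((a N).map fun x : ℕ ↦ ((x : ℝ) / ((a N).sup : ℕ)) ^ 4).sum)
      atTop atTop) (ξ : ℝ) :
    Tendsto (fun N ↦ qCharFun (a N) ξ) atTop (𝓝 (Real.exp (-(ξ ^ 2 / 2)))) := by
  have h1 : Tendsto (fun N ↦ ((a N).sup : ℕ) * |ξ / √(qVar (a N))|) atTop (𝓝 0) := by
    have := (tendsto_sup_div_sqrt_qVar ha hne h).mul_const |ξ|
    rw [zero_mul] at this
    refine this.congr fun N ↦ ?_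
    rw [abs_div, abs_of_nonneg (Real.sqrt_nonneg _)]
    ring
  have h2 : Tendsto (fun N ↦ 2 * ξ ^ 2 * (((a N).sup : ℕ) * |ξ / √(qVar (a N))|) ^ 2)
      atTop (𝓝 0) := by
    simpa using (h1.pow 2).const_mul (2 * ξ ^ 2)
  rw [tendsto_iff_norm_sub_tendsto_zero]
  refine squeeze_zero' (Eventually.of_forall fun N ↦ norm_nonneg _) ?_ h2
  filter_upwards [h1.eventually_le_const one_pos] with N hN
  exact abs_qCharFun_sub_exp_le (ha N) (hne N) hN

lemma tendstoInDistribution_iff_tendsto_charFun {Ω : ℕ → Type*} [∀ N, MeasurableSpace (Ω N)]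
    {P : ∀ N, Measure (Ω N)} [∀ N, IsProbabilityMeasure (P N)] {Y : ∀ N, Ω N → ℝ}
    {Ω' : Type*} [MeasurableSpace Ω'] {Q : Measure Ω'} [IsProbabilityMeasure Q] {Z : Ω' → ℝ}
    (hY : ∀ N, AEMeasurable (Y N) (P N)) (hZ : AEMeasurable Z Q) :
    TendstoInDistribution Y atTop Z P Q ↔
      ∀ ξ, Tendsto (fun N ↦ charFun ((P N).map (Y N)) ξ) atTop (𝓝 (charFun (Q.map Z) ξ)) :=
  ⟨fun h ↦ ProbabilityMeasure.tendsto_iff_tendsto_charFun.1 h.tendsto,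
    fun h ↦ ⟨hY, hZ, ProbabilityMeasure.tendsto_iff_tendsto_charFun.2 h⟩⟩

end

noncomputable section

/-! ### Products of sinc functions -/

lemma Real.sinc_ne_zero_of_lt_pi {x : ℝ} (h0 : 0 ≤ x) (h1 : x < Real.pi) : Real.sinc x ≠ 0 := by
  rcases h0.eq_or_lt with rfl | h0
  · simp
  · rw [Real.sinc_of_ne_zero h0.ne']
    exact div_ne_zero (Real.sin_pos_of_pos_of_lt_pi h0 h1).ne' h0.ne'

lemma dense_sinc_mul_ne_zero (c : ℝ) : Dense {x : ℝ | Real.sinc (c * x) ≠ 0} := by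
  have h : {x : ℝ | Real.sinc (c * x) = 0} ⊆ Set.range fun n : ℤ ↦ n * Real.pi / c := by
    intro x hx
    have h0 : c * x ≠ 0 := by
      intro h; simp [h] at hx
    rw [Set.mem_ofPred_eq, Real.sinc_of_ne_zero h0, div_eq_zero_iff, or_iff_left h0,
      Real.sin_eq_zero_iff] at hx
    obtain ⟨n, hn⟩ := hx
    refine ⟨n, ?_⟩
    have hc : c ≠ 0 := left_ne_zero_of_mul h0
    simp only [hn]
    field_simp
  exact ((Set.countable_range _).mono h).dense_compl ℝ

lemma apply_zero_le_of_prod_sinc_eq {m : ℕ} {t u : ℕ → ℝ} (hu : Antitone u) (hu0 : ∀ k, 0 ≤ u k)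
    (h : ∀ x, ∏ k ∈ Finset.range (m + 1), Real.sinc (t k * x) =
      ∏ k ∈ Finset.range (m + 1), Real.sinc (u k * x)) : t 0 ≤ u 0 := by
  by_contra! hlt
  have ht : 0 < t 0 := (hu0 0).trans_lt hlt
  have h1 : ∏ k ∈ Finset.range (m + 1), Real.sinc (t k * (Real.pi / t 0)) = 0 := by
    refine Finset.prod_eq_zero (Finset.mem_range.2 m.succ_pos) ?_
    rw [mul_div_cancel₀ _ ht.ne', Real.sinc_of_ne_zero Real.pi_ne_zero]
    simp
  rw [h] at h1
  obtain ⟨k, -, hk⟩ := Finset.prod_eq_zero_iff.1 h1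
  refine Real.sinc_ne_zero_of_lt_pi (mul_nonneg (hu0 k) (by positivity)) ?_ hk
  calc u k * (Real.pi / t 0) < t 0 * (Real.pi / t 0) := by
        gcongr
        exact (hu k.zero_le).trans_lt hlt
    _ = Real.pi := mul_div_cancel₀ _ ht.ne'

/-- A product of dilated sinc functions determines the dilation factors. -/
lemma eq_of_prod_sinc_eq {m : ℕ} {t u : ℕ → ℝ} (ht : Antitone t) (hu : Antitone u)
    (ht0 : ∀ k, 0 ≤ t k) (hu0 : ∀ k, 0 ≤ u k)
    (h : ∀ x, ∏ k ∈ Finset.range m, Real.sinc (t k * x) =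
      ∏ k ∈ Finset.range m, Real.sinc (u k * x)) : ∀ k < m, t k = u k := by
  induction m generalizing t u with
  | zero => simp
  | succ m ih =>
    have h0 : t 0 = u 0 := le_antisymm (apply_zero_le_of_prod_sinc_eq hu hu0 h)
      (apply_zero_le_of_prod_sinc_eq ht ht0 fun x ↦ (h x).symm)
    have h1 : (fun x ↦ ∏ k ∈ Finset.range m, Real.sinc (t (k + 1) * x))
        = fun x ↦ ∏ k ∈ Finset.range m, Real.sinc (u (k + 1) * x) := by
      refine Continuous.ext_on (dense_sinc_mul_ne_zero (t 0)) ?_ ?_ fun x hx ↦ ?_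
      · exact continuous_finsetProd _ fun k _ ↦ Real.continuous_sinc.comp (by fun_prop)
      · exact continuous_finsetProd _ fun k _ ↦ Real.continuous_sinc.comp (by fun_prop)
      · have := h x
        rw [Finset.prod_range_succ', Finset.prod_range_succ', ← h0] at this
        exact mul_right_cancel₀ hx this
    have := ih (t := fun k ↦ t (k + 1)) (u := fun k ↦ u (k + 1))
      (fun i j hij ↦ ht (by omega)) (fun i j hij ↦ hu (by omega)) (fun k ↦ ht0 _)
      (fun k ↦ hu0 _) (congrFun h1)
    rintro (_ | k) hk
    · exact h0
    · exact this k (by omega)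

/-! ### Decreasing rearrangements -/

@[to_additive]
lemma List.prod_map_eq_prod_range_getD {α M : Type*} [CommMonoid M] (l : List α) (d : α)
    (F : α → M) (hF : F d = 1) {m : ℕ} (hm : l.length ≤ m) :
    (l.map F).prod = ∏ k ∈ Finset.range m, F (l.getD k d) := by
  induction l generalizing m with
  | nil => simp [hF]
  | cons x l ih =>
    obtain ⟨m, rfl⟩ : ∃ m', m = m' + 1 := ⟨m - 1, by simp at hm; omega⟩
    rw [List.map_cons, List.prod_cons, Finset.prod_range_succ', ih (by simpa using hm)]
    simp [mul_comm]

@[to_additive]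
lemma prod_map_eq_prod_decreasingSeq {M : Type*} [CommMonoid M] (s : Multiset ℝ) (F : ℝ → M)
    (hF : F 0 = 1) {m : ℕ} (hm : s.card ≤ m) :
    (s.map F).prod = ∏ k ∈ Finset.range m, F (decreasingSeq s k) := by
  conv_lhs => rw [← Multiset.sort_eq s (fun x y ↦ x ≥ y)]
  rw [Multiset.map_coe, Multiset.prod_coe]
  exact List.prod_map_eq_prod_range_getD _ _ F hF (by simpa using hm)

lemma decreasingSeq_of_card_le {s : Multiset ℝ} {k : ℕ} (hk : s.card ≤ k) :
    decreasingSeq s k = 0 :=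
  List.getD_eq_default _ _ (by simpa using hk)

lemma decreasingSeq_mem {s : Multiset ℝ} {k : ℕ} (hk : k < s.card) : decreasingSeq s k ∈ s := by
  have hk' : k < (s.sort (fun x y ↦ x ≥ y)).length := by simpa using hk
  rw [decreasingSeq, List.getD_eq_getElem _ _ hk']
  exact (Multiset.mem_sort (fun x y ↦ x ≥ y)).1 (List.getElem_mem hk')

lemma decreasingSeq_nonneg {s : Multiset ℝ} (hs : ∀ x ∈ s, 0 ≤ x) (k : ℕ) :
    0 ≤ decreasingSeq s k := by
  rcases lt_or_ge k s.card with hk | hk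
  · exact hs _ (decreasingSeq_mem hk)
  · rw [decreasingSeq_of_card_le hk]

lemma decreasingSeq_le {s : Multiset ℝ} {B : ℝ} (hB : 0 ≤ B) (hs : ∀ x ∈ s, x ≤ B) (k : ℕ) :
    decreasingSeq s k ≤ B := by
  rcases lt_or_ge k s.card with hk | hk
  · exact hs _ (decreasingSeq_mem hk)
  · rwa [decreasingSeq_of_card_le hk]

lemma antitone_decreasingSeq {s : Multiset ℝ} (hs : ∀ x ∈ s, 0 ≤ x) :
    Antitone (decreasingSeq s) := by
  intro i j hij
  rcases lt_or_ge j s.card with hj | hj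
  · rcases hij.eq_or_lt with rfl | hij
    · exact le_rfl
    have hj' : j < (s.sort (fun x y ↦ x ≥ y)).length := by simpa using hj
    rw [decreasingSeq, decreasingSeq, List.getD_eq_getElem _ _ hj',
      List.getD_eq_getElem _ _ (hij.trans hj')]
    exact List.pairwise_iff_getElem.1 (Multiset.pairwise_sort s (fun x y ↦ x ≥ y)) i j _ _ hij
  · rw [decreasingSeq_of_card_le hj]
    exact decreasingSeq_nonneg hs i

lemma Multiset.sum_map_ite_eq_count {α : Type*} [DecidableEq α] (s : Multiset α) (r : α) :
    (s.map fun x ↦ if r = x then 1 else 0).sum = s.count r := by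
  induction s using Multiset.induction_on with
  | empty => simp
  | cons x s ih => simp [Multiset.count_cons, ih, add_comm]

lemma Multiset.eq_of_prod_sinc_eq {s u : Multiset ℝ} (hs : ∀ x ∈ s, 0 < x) (hu : ∀ x ∈ u, 0 < x)
    (h : ∀ x, (s.map fun r ↦ Real.sinc (r * x)).prod = (u.map fun r ↦ Real.sinc (r * x)).prod) :
    s = u := by
  set m := max s.card u.card
  have hs' : s.card ≤ m := le_max_left _ _
  have hu' : u.card ≤ m := le_max_right _ _
  have h1 := _root_.eq_of_prod_sinc_eq (m := m) (antitone_decreasingSeq fun x hx ↦ (hs x hx).le)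
    (antitone_decreasingSeq fun x hx ↦ (hu x hx).le)
    (decreasingSeq_nonneg fun x hx ↦ (hs x hx).le)
    (decreasingSeq_nonneg fun x hx ↦ (hu x hx).le) fun x ↦ by
      have := h x
      rwa [prod_map_eq_prod_decreasingSeq s (fun r ↦ Real.sinc (r * x)) (by simp) hs',
        prod_map_eq_prod_decreasingSeq u (fun r ↦ Real.sinc (r * x)) (by simp) hu'] at this
  classical
  ext r
  rcases eq_or_ne r 0 with rfl | hr
  · rw [Multiset.count_eq_zero.2 fun h ↦ (hs 0 h).false,
      Multiset.count_eq_zero.2 fun h ↦ (hu 0 h).false]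
  · rw [← Multiset.sum_map_ite_eq_count, ← Multiset.sum_map_ite_eq_count,
      sum_map_eq_sum_decreasingSeq s (fun x : ℝ ↦ if r = x then (1 : ℕ) else 0) (if_neg hr) hs',
      sum_map_eq_sum_decreasingSeq u (fun x : ℝ ↦ if r = x then (1 : ℕ) else 0) (if_neg hr) hu']
    exact Finset.sum_congr rfl fun k hk ↦ by rw [h1 k (Finset.mem_range.1 hk)]

/-! ### Rigidity of the standardized distribution -/

lemma Real.abs_sin_mul_lt {n : ℕ} (hn : 2 ≤ n) {θ : ℝ} (h0 : 0 < θ) (h1 : θ < Real.pi) :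
    |Real.sin (n * θ)| < n * Real.sin θ := by
  have hs := Real.sin_pos_of_pos_of_lt_pi h0 h1
  have hc : |Real.cos θ| < 1 := by
    rw [← sq_lt_one_iff_abs_lt_one]
    nlinarith [Real.sin_sq_add_cos_sq θ]
  induction n, hn using Nat.le_induction with
  | base =>
    rw [Nat.cast_ofNat, Real.sin_two_mul, abs_mul, abs_mul, abs_of_pos hs]
    norm_num
    nlinarith
  | succ n hn ih =>
    rw [Nat.cast_succ, add_mul, one_mul, Real.sin_add, add_mul, one_mul]
    refine (abs_add_le _ _).trans_lt (add_lt_add_of_lt_of_le ?_ ?_)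
    · rw [abs_mul]
      exact (mul_le_of_le_one_right (abs_nonneg _) hc.le).trans_lt ih
    · rw [abs_mul, abs_of_pos hs]
      exact mul_le_of_le_one_left hs.le (Real.abs_cos_le_one _)

lemma abs_uniformCharFun_lt_one {x : ℕ} (hx : 2 ≤ x) {s : ℝ} (h0 : 0 < s)
    (h1 : s < 2 * Real.pi) : |uniformCharFun x s| < 1 := by
  have hθ : 0 < s / 2 := by positivity
  have hθ' : s / 2 < Real.pi := by linarith
  have hs := Real.sin_pos_of_pos_of_lt_pi hθ hθ'
  have hx0 : (0 : ℝ) < x := by positivity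
  have h := uniformCharFun_mul_sinc (a := x) (by omega) s
  rw [Real.sinc_of_ne_zero hθ.ne', Real.sinc_of_ne_zero (by positivity)] at h
  have h' : uniformCharFun x s = Real.sin (x * (s / 2)) / (x * Real.sin (s / 2)) := by
    field_simp at h ⊢
    linarith
  rw [h', abs_div, abs_of_pos (by positivity : 0 < x * Real.sin (s / 2)),
    div_lt_one (by positivity)]
  exact Real.abs_sin_mul_lt hx hθ hθ'

lemma abs_uniformCharFun_two_pi {x : ℕ} (hx : x ≠ 0) :
    |uniformCharFun x (2 * Real.pi)| = 1 := by
  have hx' : (x : ℝ) ≠ 0 := by exact_mod_cast hx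
  have h : ∀ k : ℕ, Real.cos ((k - ((x : ℝ) - 1) / 2) * (2 * Real.pi))
      = (-1) ^ (x + 1) := by
    intro k
    have e : (k - ((x : ℝ) - 1) / 2) * (2 * Real.pi)
        = k * (2 * Real.pi) - ((x + 1 : ℕ) * Real.pi) + (1 : ℕ) * (2 * Real.pi) := by
      push_cast; ring
    rw [e, Real.cos_add_nat_mul_two_pi, Real.cos_nat_mul_two_pi_sub, Real.cos_nat_mul_pi]
  simp_rw [uniformCharFun, h]
  simp [hx']

lemma abs_qCharFun_lt_one {a : Multiset ℕ} (ha : ∀ x ∈ a, 2 ≤ x) (hne : a ≠ 0) {ξ : ℝ}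
    (h0 : 0 < ξ / √(qVar a)) (h1 : ξ / √(qVar a) < 2 * Real.pi) : |qCharFun a ξ| < 1 := by
  obtain ⟨x, hx⟩ := Multiset.exists_mem_of_ne_zero hne
  obtain ⟨b, rfl⟩ := Multiset.exists_cons_of_mem hx
  rw [qCharFun, Multiset.map_cons, Multiset.prod_cons, abs_mul]
  exact (mul_le_of_le_one_right (abs_nonneg _) (Multiset.abs_prod_map_le_one _ _
    fun y _ ↦ abs_uniformCharFun_le_one _ _)).trans_lt (abs_uniformCharFun_lt_one (ha x hx) h0 h1)

lemma qVar_le_of_qCharFun_eq {a b : Multiset ℕ} (ha : ∀ x ∈ a, 2 ≤ x) (hb : ∀ x ∈ b, 2 ≤ x)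
    (ha0 : a ≠ 0) (hb0 : b ≠ 0) (h : ∀ ξ, qCharFun a ξ = qCharFun b ξ) : qVar b ≤ qVar a := by
  by_contra! hlt
  have hVa := qVar_pos ha ha0
  have hsa : 0 < √(qVar a) := Real.sqrt_pos.2 hVa
  have hsb : √(qVar a) < √(qVar b) := Real.sqrt_lt_sqrt hVa.le hlt
  have hsb0 : 0 < √(qVar b) := hsa.trans hsb
  have h1 : |qCharFun a (2 * Real.pi * √(qVar a))| = 1 := by
    rw [qCharFun, mul_div_cancel_right₀ _ hsa.ne']
    clear h hlt hVa hsa hsb ha0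
    induction a using Multiset.induction_on with
    | empty => simp
    | cons x a ih =>
      have := ha x (by simp)
      rw [Multiset.map_cons, Multiset.prod_cons, abs_mul, abs_uniformCharFun_two_pi (by omega),
        ih fun y hy ↦ ha y (by simp [hy]), one_mul]
  refine (abs_qCharFun_lt_one hb hb0 (ξ := 2 * Real.pi * √(qVar a)) (by positivity) ?_).ne
    (h _ ▸ h1)
  rw [div_lt_iff₀ hsb0]
  gcongr

lemma prod_uniformCharFun_mul_sinc_pow {a : Multiset ℕ} (ha : ∀ x ∈ a, 2 ≤ x) (s : ℝ) :
    (a.map fun x ↦ uniformCharFun x s).prod * Real.sinc (s / 2) ^ a.card =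
      (a.map fun x : ℕ ↦ Real.sinc (x * (s / 2))).prod := by
  induction a using Multiset.induction_on with
  | empty => simp
  | cons x a ih =>
    have hx := ha x (by simp)
    simp only [Multiset.map_cons, Multiset.prod_cons, Multiset.card_cons]
    rw [← ih fun y hy ↦ ha y (by simp [hy]), ← uniformCharFun_mul_sinc (by omega)]
    ring

/-- The standardized distribution determines the multiset. -/
lemma eq_of_qCharFun_eq {a b : Multiset ℕ} (ha : ∀ x ∈ a, 2 ≤ x) (hb : ∀ x ∈ b, 2 ≤ x)
    (ha0 : a ≠ 0) (hb0 : b ≠ 0) (h : ∀ ξ, qCharFun a ξ = qCharFun b ξ) : a = b := by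
  have hV : qVar a = qVar b := le_antisymm
    (qVar_le_of_qCharFun_eq hb ha hb0 ha0 fun ξ ↦ (h ξ).symm)
    (qVar_le_of_qCharFun_eq ha hb ha0 hb0 h)
  have hsa : √(qVar a) ≠ 0 := (Real.sqrt_pos.2 (qVar_pos ha ha0)).ne'
  have h1 : ∀ s, (a.map fun x ↦ uniformCharFun x s).prod
      = (b.map fun x ↦ uniformCharFun x s).prod := by
    intro s
    have := h (s * √(qVar a))
    rwa [qCharFun, qCharFun, ← hV, mul_div_cancel_right₀ _ hsa] at this
  have h2 : (a + Multiset.replicate b.card 1).map (Nat.cast : ℕ → ℝ)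
      = (b + Multiset.replicate a.card 1).map (Nat.cast : ℕ → ℝ) := by
    refine Multiset.eq_of_prod_sinc_eq ?_ ?_ fun x ↦ ?_
    · simp only [Multiset.mem_map, Multiset.mem_add, Multiset.mem_replicate]
      rintro _ ⟨y, hy | ⟨-, rfl⟩, rfl⟩
      · have := ha y hy; positivity
      · simp
    · simp only [Multiset.mem_map, Multiset.mem_add, Multiset.mem_replicate]
      rintro _ ⟨y, hy | ⟨-, rfl⟩, rfl⟩
      · have := hb y hy; positivity
      · simp
    · have e1 := prod_uniformCharFun_mul_sinc_pow ha (2 * x)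
      have e2 := prod_uniformCharFun_mul_sinc_pow hb (2 * x)
      rw [mul_div_cancel_left₀ _ (two_ne_zero' ℝ)] at e1 e2
      simp only [Multiset.map_map, Multiset.map_add, Multiset.prod_add, Multiset.map_replicate,
        Multiset.prod_replicate, Function.comp_def, Nat.cast_one, one_mul]
      rw [← e1, ← e2, h1]
      ring
  have h3 := Multiset.map_injective Nat.cast_injective h2
  have h4 := congrArg (Multiset.filter (2 ≤ ·)) h3
  simpa [Multiset.filter_add, Multiset.filter_eq_self.2 ha, Multiset.filter_eq_self.2 hb,
    Multiset.filter_eq_nil.2 fun y (hy : y ∈ Multiset.replicate b.card 1) ↦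
      (by simp [Multiset.eq_of_mem_replicate hy] : ¬ 2 ≤ y),
    Multiset.filter_eq_nil.2 fun y (hy : y ∈ Multiset.replicate a.card 1) ↦
      (by simp [Multiset.eq_of_mem_replicate hy] : ¬ 2 ≤ y)] using h4

end

noncomputable section

/-! ### Uniform sums -/

lemma setIntegral_Icc_half {E : Type*} [NormedAddCommGroup E] [NormedSpace ℝ E] (f : ℝ → E) :
    ∫ x in Set.Icc (-1 / 2 : ℝ) (1 / 2), f x = ∫ x in (-1 / 2 : ℝ)..(1 / 2), f x := by
  rw [integral_Icc_eq_integral_Ioc, intervalIntegral.integral_of_le (by norm_num)]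

lemma charFun_uniformInterval (ξ : ℝ) :
    charFun ((volume : Measure ℝ).restrict (Set.Icc (-1 / 2) (1 / 2))) ξ
      = Real.sinc (ξ / 2) := by
  rw [charFun_apply_real, setIntegral_Icc_half]
  rcases eq_or_ne ξ 0 with rfl | hξ
  · simp; norm_num
  have h := intervalIntegral.integral_comp_mul_left (a := -1 / 2) (b := 1 / 2)
    (fun t : ℝ ↦ Complex.exp (t * Complex.I)) hξ
  push_cast at h
  rw [h, show ξ * (-1 / 2) = -(ξ / 2) by ring, show ξ * (1 / 2) = ξ / 2 by ring,
    integral_exp_mul_I_eq_sinc]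
  have : (ξ : ℂ) ≠ 0 := by exact_mod_cast hξ
  rw [Complex.real_smul]
  push_cast
  field_simp

lemma integral_uniformInterval :
    ∫ x, x ∂((volume : Measure ℝ).restrict (Set.Icc (-1 / 2) (1 / 2))) = 0 := by
  rw [setIntegral_Icc_half, integral_id]; norm_num

lemma integral_sq_uniformInterval :
    ∫ x, x ^ 2 ∂((volume : Measure ℝ).restrict (Set.Icc (-1 / 2) (1 / 2))) = 1 / 12 := by
  rw [setIntegral_Icc_half, integral_pow]; norm_num

lemma memLp_uniformInterval :
    MemLp (fun x ↦ x) 2 ((volume : Measure ℝ).restrict (Set.Icc (-1 / 2) (1 / 2))) := by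
  refine MemLp.of_bound (by fun_prop) (1 / 2) ?_
  filter_upwards [ae_restrict_mem measurableSet_Icc] with x hx
  rw [Real.norm_eq_abs, abs_le]
  constructor <;> linarith [hx.1, hx.2]

lemma uniformSeqMeasure_map_eval (k : ℕ) : uniformSeqMeasure.map (fun ω ↦ ω k) =
    (volume : Measure ℝ).restrict (Set.Icc (-1 / 2) (1 / 2)) :=
  Measure.infinitePi_map_eval _ k

lemma memLp_eval_uniformSeqMeasure (k : ℕ) :
    MemLp (fun ω : ℕ → ℝ ↦ ω k) 2 uniformSeqMeasure := by
  have := memLp_uniformInterval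
  rw [← uniformSeqMeasure_map_eval k,
    memLp_map_measure_iff (by fun_prop) (Measurable.aemeasurable (by fun_prop))] at this
  exact this

lemma integral_eval_uniformSeqMeasure (k : ℕ) : ∫ ω, ω k ∂uniformSeqMeasure = 0 := by
  have := integral_map (μ := uniformSeqMeasure) (φ := fun ω ↦ ω k)
    (Measurable.aemeasurable (by fun_prop))
    (f := fun x : ℝ ↦ x) (by fun_prop)
  rw [← this, uniformSeqMeasure_map_eval, integral_uniformInterval]

lemma variance_eval_uniformSeqMeasure (k : ℕ) :
    Var[fun ω ↦ ω k; uniformSeqMeasure] = 1 / 12 := by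
  have := integral_map (μ := uniformSeqMeasure) (φ := fun ω ↦ ω k)
    (Measurable.aemeasurable (by fun_prop))
    (f := fun x : ℝ ↦ x ^ 2) (by fun_prop)
  rw [variance_of_integral_eq_zero (Measurable.aemeasurable (by fun_prop)) (integral_eval_uniformSeqMeasure k), ← this,
    uniformSeqMeasure_map_eval, integral_sq_uniformInterval]

lemma iIndepFun_mul_eval (t : ℕ → ℝ) :
    iIndepFun (fun k (ω : ℕ → ℝ) ↦ t k * ω k) uniformSeqMeasure :=
  iIndepFun_infinitePi (X := fun k x ↦ t k * x) fun k ↦ by fun_prop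

variable {m : ℕ} {t : ℕ → ℝ}

lemma uniformSum_eq (ht : ∀ k, m ≤ k → t k = 0) :
    uniformSum t = fun ω ↦ ∑ k ∈ Finset.range m, t k * ω k := by
  ext ω
  refine Tendsto.limUnder_eq (tendsto_const_nhds.congr' ?_)
  filter_upwards [eventually_ge_atTop m] with n hn
  refine Finset.sum_subset (Finset.range_mono hn) fun k _ hk ↦ ?_
  rw [ht k (by simpa using hk), zero_mul]

lemma integral_uniformSum (ht : ∀ k, m ≤ k → t k = 0) :
    ∫ ω, uniformSum t ω ∂uniformSeqMeasure = 0 := by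
  rw [uniformSum_eq ht, integral_finsetSum]
  · simp [integral_const_mul, integral_eval_uniformSeqMeasure]
  · exact fun k _ ↦ ((memLp_eval_uniformSeqMeasure k).integrable (by norm_num)).const_mul _

lemma variance_uniformSum (ht : ∀ k, m ≤ k → t k = 0) :
    Var[uniformSum t; uniformSeqMeasure] = (∑ k ∈ Finset.range m, t k ^ 2) / 12 := by
  have e : uniformSum t = ∑ k ∈ Finset.range m, fun ω ↦ t k * ω k := by
    rw [uniformSum_eq ht]; ext ω; simp
  rw [e, IndepFun.variance_sum]
  · simp_rw [variance_const_mul, variance_eval_uniformSeqMeasure, Finset.sum_div]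
    exact Finset.sum_congr rfl fun k _ ↦ by ring
  · exact fun k _ ↦ (memLp_eval_uniformSeqMeasure k).const_mul _
  · exact fun i _ j _ hij ↦ (iIndepFun_mul_eval t).indepFun hij

lemma standardize_uniformSum (ht : ∀ k, m ≤ k → t k = 0)
    (ht2 : ∑ k ∈ Finset.range m, t k ^ 2 = 1) :
    standardize (uniformSum t) uniformSeqMeasure =
      fun ω ↦ (2 * √3) * ∑ k ∈ Finset.range m, t k * ω k := by
  ext ω
  rw [standardize, integral_uniformSum ht, variance_uniformSum ht, ht2, uniformSum_eq ht]
  have : √(1 / 12 : ℝ) = (2 * √3)⁻¹ := by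
    rw [Real.sqrt_eq_iff_mul_self_eq (by norm_num) (by positivity), ← mul_inv, mul_mul_mul_comm,
      Real.mul_self_sqrt (by norm_num)]
    norm_num
  rw [this, div_inv_eq_mul, sub_zero, mul_comm]

lemma aemeasurable_standardize_uniformSum (ht : ∀ k, m ≤ k → t k = 0)
    (ht2 : ∑ k ∈ Finset.range m, t k ^ 2 = 1) :
    AEMeasurable (standardize (uniformSum t) uniformSeqMeasure) uniformSeqMeasure := by
  rw [standardize_uniformSum ht ht2]
  exact Measurable.aemeasurable (by fun_prop)

lemma charFun_standardize_uniformSum (ht : ∀ k, m ≤ k → t k = 0)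
    (ht2 : ∑ k ∈ Finset.range m, t k ^ 2 = 1) (ξ : ℝ) :
    charFun (uniformSeqMeasure.map (standardize (uniformSum t) uniformSeqMeasure)) ξ =
      (∏ k ∈ Finset.range m, Real.sinc (t k * (√3 * ξ)) : ℝ) := by
  rw [standardize_uniformSum ht ht2, charFun_map_mul_comp (Measurable.aemeasurable (by fun_prop)),
    ((iIndepFun_mul_eval t).restrict _).charFun_map_fun_finsetSum_eq_prod
      (fun _ _ ↦ Measurable.aemeasurable (by fun_prop)), Finset.prod_apply, Complex.ofReal_prod]
  refine Finset.prod_congr rfl fun k _ ↦ ?_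
  rw [charFun_map_mul_comp (Measurable.aemeasurable (by fun_prop)), uniformSeqMeasure_map_eval, charFun_uniformInterval]
  congr 2
  ring

/-! ### Rescaled multisets -/

/-- The Euclidean norm of a multiset. -/
def euclNorm (a : Multiset ℕ) : ℝ := √((a.map fun y : ℕ ↦ (y : ℝ) ^ 2).sum)

lemma euclNorm_sq (a : Multiset ℕ) :
    euclNorm a ^ 2 = (a.map fun y : ℕ ↦ (y : ℝ) ^ 2).sum := by
  refine Real.sq_sqrt (Multiset.sum_nonneg ?_)
  simp only [Multiset.mem_map]
  rintro _ ⟨y, _, rfl⟩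
  positivity

lemma euclNorm_pos {a : Multiset ℕ} (ha : ∀ x ∈ a, 2 ≤ x) (hne : a ≠ 0) : 0 < euclNorm a :=
  Real.sqrt_pos.2 (sum_sq_pos ha hne)

lemma rescaled_eq (a : Multiset ℕ) : rescaled a = a.map fun x : ℕ ↦ (x : ℝ) / euclNorm a := rfl

lemma card_rescaled (a : Multiset ℕ) : (rescaled a).card = a.card := by simp [rescaled]

lemma rescaled_nonneg (a : Multiset ℕ) : ∀ x ∈ rescaled a, 0 ≤ x := by
  rw [rescaled_eq]
  simp only [Multiset.mem_map]
  rintro _ ⟨y, _, rfl⟩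
  have : 0 ≤ euclNorm a := Real.sqrt_nonneg _
  positivity

lemma sum_sq_rescaled {a : Multiset ℕ} (ha : ∀ x ∈ a, 2 ≤ x) (hne : a ≠ 0) :
    ((rescaled a).map (· ^ 2)).sum = 1 := by
  have h := euclNorm_pos ha hne
  rw [rescaled_eq, Multiset.map_map]
  simp only [Function.comp_def, div_pow]
  rw [Multiset.sum_map_div, ← euclNorm_sq, div_self (by positivity)]

lemma sum_sq_decreasingSeq_rescaled {a : Multiset ℕ} (ha : ∀ x ∈ a, 2 ≤ x) (hne : a ≠ 0)
    (hm : a.card ≤ m) : ∑ k ∈ Finset.range m, decreasingSeq (rescaled a) k ^ 2 = 1 := by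
  rw [← sum_sq_rescaled ha hne]
  exact (sum_map_eq_sum_decreasingSeq (rescaled a) (· ^ 2) (by simp)
    (by rwa [card_rescaled])).symm

lemma decreasingSeq_rescaled_mem_Icc {a : Multiset ℕ} (ha : ∀ x ∈ a, 2 ≤ x) (hne : a ≠ 0)
    (k : ℕ) : decreasingSeq (rescaled a) k ∈ Set.Icc (0 : ℝ) 1 := by
  refine ⟨decreasingSeq_nonneg (rescaled_nonneg a) k,
    decreasingSeq_le zero_le_one (fun x hx ↦ ?_) k⟩
  rw [← sq_le_one_iff₀ (rescaled_nonneg a x hx), ← sum_sq_rescaled ha hne]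
  refine Multiset.single_le_sum ?_ _ (Multiset.mem_map_of_mem _ hx)
  simp only [Multiset.mem_map]
  rintro _ ⟨y, _, rfl⟩
  positivity

lemma qCharFun_mul_sinc_pow {a : Multiset ℕ} (ha : ∀ x ∈ a, 2 ≤ x) (hne : a ≠ 0)
    (hm : a.card ≤ m) (ξ : ℝ) :
    qCharFun a ξ * Real.sinc (ξ / √(qVar a) / 2) ^ a.card =
      ∏ k ∈ Finset.range m, Real.sinc (decreasingSeq (rescaled a) k *
        (euclNorm a / √(qVar a) / 2 * ξ)) := by
  have h := euclNorm_pos ha hne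
  rw [qCharFun, prod_uniformCharFun_mul_sinc_pow ha,
    ← prod_map_eq_prod_decreasingSeq (rescaled a)
      (fun r ↦ Real.sinc (r * (euclNorm a / √(qVar a) / 2 * ξ))) (by simp)
      (by rwa [card_rescaled]), rescaled_eq, Multiset.map_map]
  congr 1
  refine Multiset.map_congr rfl fun x _ ↦ ?_
  simp only [Function.comp_apply]
  congr 1
  field_simp

lemma qVar_eq (a : Multiset ℕ) : qVar a = (euclNorm a ^ 2 - a.card) / 12 := by
  rw [euclNorm_sq, qVar, Multiset.sum_map_div, Multiset.sum_map_sub]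
  simp

lemma sup_le_euclNorm_sq (a : Multiset ℕ) : ((a.sup : ℕ) : ℝ) ≤ euclNorm a ^ 2 := by
  have h : a.sup ≤ (a.map (· ^ 2)).sum := by
    refine Multiset.sup_le.2 fun x hx ↦ ?_
    exact (Nat.le_self_pow two_ne_zero x).trans
      (Multiset.single_le_sum (fun _ _ ↦ Nat.zero_le _) _ (Multiset.mem_map_of_mem _ hx))
  rw [euclNorm_sq]
  refine (Nat.cast_le.2 h).trans_eq ?_
  rw [Nat.cast_multiset_sum, Multiset.map_map]
  simp

variable {a : ℕ → Multiset ℕ}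

lemma tendsto_euclNorm_sq (hsup : Tendsto (fun N ↦ (a N).sup) atTop atTop) :
    Tendsto (fun N ↦ euclNorm (a N) ^ 2) atTop atTop :=
  tendsto_atTop_mono (fun N ↦ sup_le_euclNorm_sq (a N))
    (tendsto_natCast_atTop_atTop.comp hsup)

lemma tendsto_sqrt_qVar (ha : ∀ N, ∀ x ∈ a N, 2 ≤ x)
    (hsup : Tendsto (fun N ↦ (a N).sup) atTop atTop) :
    Tendsto (fun N ↦ √(qVar (a N))) atTop atTop := by
  refine Real.tendsto_sqrt_atTop.comp (tendsto_atTop_mono (fun N ↦ ?_)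
    ((tendsto_euclNorm_sq hsup).atTop_div_const (by norm_num : (0 : ℝ) < 16)))
  rw [euclNorm_sq]
  exact sum_sq_le_qVar (ha N)

lemma tendsto_euclNorm_div_sqrt_qVar (ha : ∀ N, ∀ x ∈ a N, 2 ≤ x) (hne : ∀ N, a N ≠ 0)
    (hm : ∀ N, (a N).card ≤ m) (hsup : Tendsto (fun N ↦ (a N).sup) atTop atTop) :
    Tendsto (fun N ↦ euclNorm (a N) / √(qVar (a N)) / 2) atTop (𝓝 √3) := by
  have h1 : Tendsto (fun N ↦ ((a N).card : ℝ) / euclNorm (a N) ^ 2) atTop (𝓝 0) := by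
    refine squeeze_zero (fun N ↦ by positivity) (fun N ↦ ?_)
      ((tendsto_euclNorm_sq hsup).const_div_atTop (m : ℝ))
    gcongr
    exact_mod_cast hm N
  have h2 : Tendsto (fun N ↦ √(3 / (1 - ((a N).card : ℝ) / euclNorm (a N) ^ 2)))
      atTop (𝓝 √3) := by
    have := (tendsto_const_nhds (x := (3 : ℝ))).div ((tendsto_const_nhds (x := (1 : ℝ))).sub h1)
      (by norm_num)
    rw [sub_zero, div_one] at this
    exact (Real.continuous_sqrt.tendsto _).comp this
  refine h2.congr fun N ↦ ?_
  have hE := euclNorm_pos (ha N) (hne N)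
  have hV := qVar_pos (ha N) (hne N)
  rw [Real.sqrt_eq_iff_mul_self_eq_of_pos (by positivity)]
  have hs : √(qVar (a N)) * √(qVar (a N)) = qVar (a N) := Real.mul_self_sqrt hV.le
  have e : euclNorm (a N) / √(qVar (a N)) / 2 * (euclNorm (a N) / √(qVar (a N)) / 2)
      = euclNorm (a N) ^ 2 / qVar (a N) / 4 := by
    rw [← hs]; field_simp; norm_num
  have e' : 1 - ((a N).card : ℝ) / euclNorm (a N) ^ 2 = 12 * qVar (a N) / euclNorm (a N) ^ 2 := by
    rw [qVar_eq]; field_simp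
  rw [e, e']
  field_simp
  norm_num

lemma tendsto_sinc_pow_card (ha : ∀ N, ∀ x ∈ a N, 2 ≤ x)
    (hm : ∀ N, (a N).card ≤ m) (hsup : Tendsto (fun N ↦ (a N).sup) atTop atTop) (ξ : ℝ) :
    Tendsto (fun N ↦ Real.sinc (ξ / √(qVar (a N)) / 2) ^ (a N).card) atTop (𝓝 1) := by
  have h1 : Tendsto (fun N ↦ Real.sinc (ξ / √(qVar (a N)) / 2)) atTop (𝓝 1) := by
    have := ((tendsto_sqrt_qVar ha hsup).const_div_atTop ξ).div_const 2
    rw [zero_div] at this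
    simpa [Function.comp_def] using (Real.continuous_sinc.tendsto 0).comp this
  have h2 := h1.pow m
  rw [one_pow] at h2
  refine tendsto_of_tendsto_of_tendsto_of_le_of_le' h2 tendsto_const_nhds ?_ ?_
  · filter_upwards [h1.eventually_const_le one_half_lt_one] with N hN
    exact pow_le_pow_of_le_one (by linarith) (Real.sinc_le_one _) (hm N)
  · filter_upwards [h1.eventually_const_le one_half_lt_one] with N hN
    exact pow_le_one₀ (by linarith) (Real.sinc_le_one _)

lemma tendsto_qCharFun_prod_sinc (ha : ∀ N, ∀ x ∈ a N, 2 ≤ x) (hne : ∀ N, a N ≠ 0)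
    (hm : ∀ N, (a N).card ≤ m) (hsup : Tendsto (fun N ↦ (a N).sup) atTop atTop)
    (ht : ∀ k, Tendsto (fun N ↦ decreasingSeq (rescaled (a N)) k) atTop (𝓝 (t k))) (ξ : ℝ) :
    Tendsto (fun N ↦ qCharFun (a N) ξ) atTop
      (𝓝 (∏ k ∈ Finset.range m, Real.sinc (t k * (√3 * ξ)))) := by
  have h1 := tendsto_sinc_pow_card ha hm hsup ξ
  have h2 : Tendsto (fun N ↦ ∏ k ∈ Finset.range m, Real.sinc (decreasingSeq (rescaled (a N)) k *
        (euclNorm (a N) / √(qVar (a N)) / 2 * ξ))) atTop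
      (𝓝 (∏ k ∈ Finset.range m, Real.sinc (t k * (√3 * ξ)))) :=
    tendsto_finsetProd _ fun k _ ↦ (Real.continuous_sinc.tendsto _).comp
      ((ht k).mul ((tendsto_euclNorm_div_sqrt_qVar ha hne hm hsup).mul_const ξ))
  have h3 := h2.div h1 one_ne_zero
  rw [div_one] at h3
  refine h3.congr' ?_
  filter_upwards [h1.eventually_ne one_ne_zero] with N hN
  rw [Pi.div_apply, ← qCharFun_mul_sinc_pow (ha N) (hne N) (hm N), mul_div_cancel_right₀ _ hN]

lemma decreasingSpace.eq_zero (ht : t ∈ decreasingSpace m) {k : ℕ} (hk : m ≤ k) : t k = 0 := by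
  obtain ⟨hanti, h0, hcard⟩ := ht
  by_contra hne
  have hpos : 0 < t k := lt_of_le_of_ne (h0 k) (Ne.symm hne)
  have hsub : (Finset.range (m + 1) : Set ℕ) ⊆ Function.support t := by
    intro j hj
    have hj : j < m + 1 := by simpa using hj
    exact (hpos.trans_le (hanti (by omega : j ≤ k))).ne'
  have := (Set.encard_le_encard hsub).trans hcard
  rw [Set.encard_coe_eq_coe_finsetCard, Finset.card_range] at this
  exact absurd (by exact_mod_cast this : m + 1 ≤ m) (by omega)

lemma mem_decreasingSpace_of_tendsto (hm : ∀ N, (a N).card ≤ m)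
    (ht : ∀ k, Tendsto (fun N ↦ decreasingSeq (rescaled (a N)) k) atTop (𝓝 (t k))) :
    t ∈ decreasingSpace m := by
  refine ⟨fun i j hij ↦ ?_, fun k ↦ ?_, ?_⟩
  · exact le_of_tendsto_of_tendsto' (ht j) (ht i) fun N ↦
      antitone_decreasingSeq (rescaled_nonneg _) hij
  · exact ge_of_tendsto' (ht k) fun N ↦ decreasingSeq_nonneg (rescaled_nonneg _) k
  · have hsub : Function.support t ⊆ (Finset.range m : Set ℕ) := by
      intro k hk
      by_contra hkm
      have hkm : m ≤ k := by simpa using hkm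
      refine hk (tendsto_nhds_unique (ht k) (tendsto_const_nhds.congr fun N ↦ ?_))
      exact (decreasingSeq_of_card_le (by rw [card_rescaled]; exact (hm N).trans hkm)).symm
    refine (Set.encard_le_encard hsub).trans ?_
    rw [Set.encard_coe_eq_coe_finsetCard, Finset.card_range]

lemma sum_sq_eq_one_of_tendsto (ha : ∀ N, ∀ x ∈ a N, 2 ≤ x) (hne : ∀ N, a N ≠ 0)
    (hm : ∀ N, (a N).card ≤ m)
    (ht : ∀ k, Tendsto (fun N ↦ decreasingSeq (rescaled (a N)) k) atTop (𝓝 (t k))) :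
    ∑ k ∈ Finset.range m, t k ^ 2 = 1 := by
  refine tendsto_nhds_unique (tendsto_finsetSum (Finset.range m) fun k _ ↦ (ht k).pow 2) ?_
  refine tendsto_const_nhds.congr fun N ↦ ?_
  exact (sum_sq_decreasingSeq_rescaled (ha N) (hne N) (hm N)).symm

lemma exists_tendsto_decreasingSeq_of_tendsto_qCharFun (ha : ∀ N, ∀ x ∈ a N, 2 ≤ x)
    (hne : ∀ N, a N ≠ 0) (hm : ∀ N, (a N).card ≤ m)
    (hsup : Tendsto (fun N ↦ (a N).sup) atTop atTop) {φ : ℝ → ℝ}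
    (hφ : ∀ ξ, Tendsto (fun N ↦ qCharFun (a N) ξ) atTop (𝓝 (φ ξ))) :
    ∃ t ∈ decreasingSpace m,
      ∀ k, Tendsto (fun N ↦ decreasingSeq (rescaled (a N)) k) atTop (𝓝 (t k)) := by
  set D : ℕ → ℕ → ℝ := fun N ↦ decreasingSeq (rescaled (a N)) with hD
  have hK : IsSeqCompact (Set.univ.pi fun _ : ℕ ↦ Set.Icc (0 : ℝ) 1) :=
    (isCompact_univ_pi fun _ ↦ isCompact_Icc).isSeqCompact
  have hsub : ∀ ns : ℕ → ℕ, Tendsto ns atTop atTop → ∃ ms : ℕ → ℕ, ∃ t ∈ decreasingSpace m,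
      Tendsto (fun n ↦ D (ns (ms n))) atTop (𝓝 t) ∧
        ∀ ξ, ∏ k ∈ Finset.range m, Real.sinc (t k * (√3 * ξ)) = φ ξ := by
    intro ns hns
    obtain ⟨t, -, ms, hms, hlim⟩ := hK (x := fun n ↦ D (ns n)) fun n k _ ↦
      decreasingSeq_rescaled_mem_Icc (ha _) (hne _) k
    have hlim' := tendsto_pi_nhds.1 hlim
    have hns' := hns.comp hms.tendsto_atTop
    refine ⟨ms, t, mem_decreasingSpace_of_tendsto (a := fun n ↦ a (ns (ms n)))
      (fun n ↦ hm _) hlim', hlim, fun ξ ↦ ?_⟩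
    exact tendsto_nhds_unique (tendsto_qCharFun_prod_sinc (a := fun n ↦ a (ns (ms n)))
      (fun n ↦ ha _) (fun n ↦ hne _) (fun n ↦ hm _) (hsup.comp hns') hlim' ξ)
      ((hφ ξ).comp hns')
  obtain ⟨_, t, ht, -, htφ⟩ := hsub id tendsto_id
  refine ⟨t, ht, tendsto_pi_nhds.1 (tendsto_of_subseq_tendsto fun ns hns ↦ ?_)⟩
  obtain ⟨ms, u, hu, hlim, huφ⟩ := hsub ns hns
  refine ⟨ms, ?_⟩
  convert hlim using 2
  ext k
  rcases lt_or_ge k m with hk | hk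
  · refine eq_of_prod_sinc_eq ht.1 hu.1 ht.2.1 hu.2.1 (fun x ↦ ?_) k hk
    have h3 : √3 * (x / √3) = x := mul_div_cancel₀ _ (by positivity)
    rw [← h3, htφ, huφ]
  · rw [decreasingSpace.eq_zero ht hk, decreasingSpace.eq_zero hu hk]

lemma Multiset.finite_card_le_sup_le (m M : ℕ) :
    {a : Multiset ℕ | a.card ≤ m ∧ a.sup ≤ M}.Finite := by
  refine (Set.finite_Icc 0 (m • Multiset.range (M + 1))).subset fun a ⟨hm, hM⟩ ↦
    ⟨Multiset.zero_le a, Multiset.le_iff_count.2 fun x ↦ ?_⟩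
  by_cases hx : x ∈ a
  · have hx' : x ∈ Multiset.range (M + 1) :=
      Multiset.mem_range.2 (Nat.lt_succ_of_le ((Multiset.le_sup hx).trans hM))
    rw [Multiset.count_nsmul]
    exact ((Multiset.count_le_card x a).trans hm).trans
      (Nat.le_mul_of_pos_right m (Multiset.count_pos.2 hx'))
  · rw [Multiset.count_eq_zero.2 hx]
    exact Nat.zero_le _

lemma eventually_eq_of_tendsto_qCharFun (ha : ∀ N, ∀ x ∈ a N, 2 ≤ x)
    (hne : ∀ N, a N ≠ 0) {M : ℕ} (hm : ∀ N, (a N).card ≤ m) (hM : ∀ N, (a N).sup ≤ M)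
    {φ : ℝ → ℝ} (hφ : ∀ ξ, Tendsto (fun N ↦ qCharFun (a N) ξ) atTop (𝓝 (φ ξ))) :
    ∃ b : Multiset ℕ, ∀ᶠ N in atTop, a N = b := by
  have h1 : ∀ᶠ N in atTop, ∀ b ∈ {a : Multiset ℕ | a.card ≤ m ∧ a.sup ≤ M},
      a N = b → ∀ ξ, qCharFun b ξ = φ ξ := by
    refine (eventually_all_finite (Multiset.finite_card_le_sup_le m M)).2 fun b _ ↦ ?_
    by_cases hb : ∃ᶠ N in atTop, a N = b
    · refine Eventually.of_forall fun _ _ ξ ↦ ?_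
      exact (tendsto_nhds_unique_of_frequently_eq (hφ ξ) tendsto_const_nhds
        (hb.mono fun N hN ↦ by rw [hN])).symm
    · filter_upwards [not_frequently.1 hb] with N hN h using absurd h hN
  have h2 : ∀ᶠ N in atTop, ∀ ξ, qCharFun (a N) ξ = φ ξ :=
    h1.mono fun N hN ↦ hN (a N) ⟨hm N, hM N⟩ rfl
  obtain ⟨N₀, hN₀⟩ := h2.exists
  refine ⟨a N₀, h2.mono fun N hN ↦ eq_of_qCharFun_eq (ha N) (ha N₀) (hne N) (hne N₀) fun ξ ↦ ?_⟩
  rw [hN, hN₀]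

end

theorem theorem4p1 {Ω : ℕ → Type*} [∀ N, MeasurableSpace (Ω N)]
    (P : ∀ N, Measure (Ω N)) [∀ N, IsProbabilityMeasure (P N)]
    (a : ℕ → Multiset ℕ) (ha : ∀ N, ∀ x ∈ a N, 2 ≤ x) (hne : ∀ N, a N ≠ 0)
    (X : ∀ N, Ω N → ℝ) (hX : ∀ N, IsAssociated (qProd (a N)) (X N) (P N)) :
    -- (i)
    (Tendsto (fun N ↦ ((a N).map fun x : ℕ ↦ ((x : ℝ) / ((a N).sup : ℕ)) ^ 4).sum) atTop atTop →
      AsymptoticallyNormal X P) ∧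
    -- (ii)
    (∀ m : ℕ, (∀ N, (a N).card ≤ m) → Tendsto (fun N ↦ (a N).sup) atTop atTop →
      (ConvergesInDistribution (fun N ↦ standardize (X N) (P N)) P ↔
        ∃ t ∈ decreasingSpace m,
          ∀ k, Tendsto (fun N ↦ decreasingSeq (rescaled (a N)) k) atTop (𝓝 (t k))) ∧
      (∀ t ∈ decreasingSpace m,
        (∀ k, Tendsto (fun N ↦ decreasingSeq (rescaled (a N)) k) atTop (𝓝 (t k))) →
        TendstoInDistribution (fun N ↦ standardize (X N) (P N)) atTop
          (standardize (uniformSum t) uniformSeqMeasure) P uniformSeqMeasure)) ∧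
    -- (iii)
    ((∃ m : ℕ, ∀ N, (a N).card ≤ m) → (∃ M : ℕ, ∀ N, (a N).sup ≤ M) →
      (ConvergesInDistribution (fun N ↦ standardize (X N) (P N)) P ↔
        ∃ b : Multiset ℕ, ∀ᶠ N in atTop, a N = b)) := by
  have hmeas := fun N ↦ (hX N).aemeasurable_standardize
  have hcf := fun N ξ ↦ (hX N).charFun_standardize_qProd (ha N) ξ
  have hconv : ConvergesInDistribution (fun N ↦ standardize (X N) (P N)) P →
      ∃ φ : ℝ → ℝ, ∀ ξ, Tendsto (fun N ↦ qCharFun (a N) ξ) atTop (𝓝 (φ ξ)) := by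
    rintro ⟨ν, hν⟩
    have h := (tendstoInDistribution_iff_tendsto_charFun hmeas aemeasurable_id).1 hν
    refine ⟨fun ξ ↦ (charFun ((ν : Measure ℝ).map id) ξ).re, fun ξ ↦ ?_⟩
    simpa [hcf, Function.comp_def] using (Complex.continuous_re.tendsto _).comp (h ξ)
  have hsum : ∀ m : ℕ, (∀ N, (a N).card ≤ m) → Tendsto (fun N ↦ (a N).sup) atTop atTop →
      ∀ t ∈ decreasingSpace m,
        (∀ k, Tendsto (fun N ↦ decreasingSeq (rescaled (a N)) k) atTop (𝓝 (t k))) →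
        TendstoInDistribution (fun N ↦ standardize (X N) (P N)) atTop
          (standardize (uniformSum t) uniformSeqMeasure) P uniformSeqMeasure := by
    intro m hm hsup t ht hlim
    have ht0 : ∀ k, m ≤ k → t k = 0 := fun k ↦ decreasingSpace.eq_zero ht
    have ht2 := sum_sq_eq_one_of_tendsto ha hne hm hlim
    refine (tendstoInDistribution_iff_tendsto_charFun hmeas
      (aemeasurable_standardize_uniformSum ht0 ht2)).2 fun ξ ↦ ?_
    simp_rw [hcf, charFun_standardize_uniformSum ht0 ht2]
    exact (Complex.continuous_ofReal.tendsto _).comp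
      (tendsto_qCharFun_prod_sinc ha hne hm hsup hlim ξ)
  have hlaw : ∀ {Ω' : Type} [MeasurableSpace Ω'] {Q : Measure Ω'} [IsProbabilityMeasure Q]
      {Z : Ω' → ℝ}, TendstoInDistribution (fun N ↦ standardize (X N) (P N)) atTop Z P Q →
      ConvergesInDistribution (fun N ↦ standardize (X N) (P N)) P := by
    intro Ω' _ Q _ Z h
    obtain ⟨ν, hν⟩ : ∃ ν : ProbabilityMeasure ℝ, (ν : Measure ℝ) = Q.map Z :=
      ⟨⟨Q.map Z, Measure.isProbabilityMeasure_map h.aemeasurable_limit⟩, rfl⟩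
    refine ⟨ν, ?_⟩
    refine (tendstoInDistribution_iff_tendsto_charFun hmeas aemeasurable_id).2 fun ξ ↦ ?_
    simpa [hν] using (tendstoInDistribution_iff_tendsto_charFun hmeas h.aemeasurable_limit).1 h ξ
  refine ⟨fun h ↦ ?_, fun m hm hsup ↦ ⟨⟨fun h ↦ ?_, fun ⟨t, ht, hlim⟩ ↦ ?_⟩,
    hsum m hm hsup⟩, fun ⟨m, hm⟩ ⟨M, hM⟩ ↦ ⟨fun h ↦ ?_, fun ⟨b, hb⟩ ↦ ?_⟩⟩
  · refine (tendstoInDistribution_iff_tendsto_charFun hmeas aemeasurable_id).2 fun ξ ↦ ?_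
    simp_rw [hcf]
    have e : charFun ((gaussianReal 0 1).map id) ξ = (Real.exp (-(ξ ^ 2 / 2)) : ℝ) := by
      simp [Measure.map_id, charFun_gaussianReal]
    rw [e]
    exact (Complex.continuous_ofReal.tendsto _).comp (tendsto_qCharFun_exp ha hne h ξ)
  · obtain ⟨φ, hφ⟩ := hconv h
    exact exists_tendsto_decreasingSeq_of_tendsto_qCharFun ha hne hm hsup hφ
  · exact hlaw (hsum m hm hsup t ht hlim)
  · obtain ⟨φ, hφ⟩ := hconv h
    exact eventually_eq_of_tendsto_qCharFun ha hne hm hM hφ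
  · obtain ⟨N₀, hN₀⟩ := hb.exists
    obtain ⟨ν, hν⟩ : ∃ ν : ProbabilityMeasure ℝ,
        (ν : Measure ℝ) = (P N₀).map (standardize (X N₀) (P N₀)) :=
      ⟨⟨_, Measure.isProbabilityMeasure_map (hmeas N₀)⟩, rfl⟩
    refine ⟨ν, ?_⟩
    refine (tendstoInDistribution_iff_tendsto_charFun hmeas aemeasurable_id).2 fun ξ ↦ ?_
    refine tendsto_const_nhds.congr' ?_
    filter_upwards [hb] with N hN
    rw [Measure.map_id, hν, hcf, hcf, hN, hN₀]
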